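/- For $n\ge 0$ and $q\in\mathbb{R}$ let $A_n(x;q)$ be the Foata–Schützenberger $q$-Eulerian polynomial, defined by $$A_0(x;q)=1,\qquad A_n(x;q)=\sum_{\pi\in S_n}x^{\mathrm{exc}(\pi)}q^{c(\pi)}\quad(n\ge 1),$$ where $\mathrm{exc}(\pi)$ is the number of indices $i$ with $\pi(i)>i$ and $c(\pi)$ is the number of cycles of $\pi$, fixed points included. Let $q\in\mathbb{R}$ and let $n\ge 0$ be an integer. (a) If $q>0$ and $n\ge 2$, then all complex zeros of $A_n(x;q)$ are real, nonpositive and simple. (b) If $n+q\le 0$ and $q\ne 0$, then all complex zeros of $A_{n+1}(x;q)$ are real and lie in $[1,\infty)$. (c) If $q$ is a negative integer, then all complex zeros of $A_n(x;q)$ are real and lie in $[1,\infty)$, and $(x-1)^m$ divides $A_n(x;q)$ while $(x-1)^{m+1}$ does not, where $m=\max\{n+q,0\}$. In particular, $A_n(x;-1)=-(x-1)^{n-1}$ for $n\ge 1$. (A nonzero constant polynomial has no zeros and satisfies the assertions about zeros vacuously.) -/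

import Mathlib

open Polynomial

/-- The number of excedances of a permutation, i.e. of indices `i` with `π i > i`. -/
def excedances {n : ℕ} (π : Equiv.Perm (Fin n)) : ℕ :=
  (Finset.univ.filter fun i : Fin n => i < π i).card

/-- The number of cycles of a permutation, fixed points included: the number of cycles of
length at least two in its disjoint cycle decomposition plus the number of fixed points. -/
def cycleNumber {n : ℕ} (π : Equiv.Perm (Fin n)) : ℕ :=
  π.cycleFactorsFinset.card + (Finset.univ.filter fun i : Fin n => π i = i).card

/-- The `q`-Eulerian polynomial of Foata and Schützenberger, the sum over all permutations `π` of
`n` letters of `q ^ c(π) * x ^ exc(π)`. For `n = 0` the only permutation contributes `1`. -/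
noncomputable def qEulerian (n : ℕ) (q : ℝ) : ℝ[X] :=
  ∑ π : Equiv.Perm (Fin n), C (q ^ cycleNumber π) * X ^ excedances π

/-- `RZ p I`: all complex zeros of the real polynomial `p` are real and lie in `I`.
(A nonzero constant satisfies this for every `I`, the zero polynomial for none.) -/
def RZ (p : ℝ[X]) (I : Set ℝ) : Prop :=
  ∀ z : ℂ, aeval z p = 0 → ∃ x ∈ I, z = (x : ℂ)

/-! Everything follows from the recurrence A_{n+1} = (nx + q) A_n + x(1 - x) A_n', obtained by
inserting a new smallest letter into a permutation of n letters (`qEulerian_succ`).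

Suppose A_n has only real zeros r, and z is a zero of A_{n+1} but not of A_n. Expanding (z - c)
A_n'/A_n at c = 1 or c = 0 turns the recurrence into "a partial fraction in z with nonnegative
residues equals a nonzero real constant". Off the real axis such a fraction is zero or has nonzero
imaginary part, so z is real. The sign of the constant, which comes from the degree bound deg A_n <
n, places z on the correct side of all poles.

For q > 0, simplicity comes from a Laguerre type inequality. For q a negative integer, once n + q ≥
0 each step splits off one factor x - 1, and the cofactor obeys a recurrence handled by the same
partial fraction argument. -/

/-! ### Cycle numbers under insertion of a smallest letter -/

open Equiv in
theorem card_quotient_sameCycle {n : ℕ} (σ : Perm (Fin n)) :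
    Nat.card (Quotient (Perm.SameCycle.setoid σ)) = cycleNumber σ := by
  classical
  let f : Fin n → {c // c ∈ σ.cycleFactorsFinset} ⊕ {i : Fin n // σ i = i} := fun x =>
    if h : σ x = x then Sum.inr ⟨x, h⟩
    else Sum.inl ⟨σ.cycleOf x, Perm.cycleOf_mem_cycleFactorsFinset_iff.2 (Perm.mem_support.2 h)⟩
  have key : ∀ x y, f x = f y ↔ σ.SameCycle x y := by
    intro x y
    by_cases hx : σ x = x <;> by_cases hy : σ y = y
    · simp only [f, hx, hy, dif_pos, Sum.inr.injEq, Subtype.mk.injEq]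
      constructor
      · rintro rfl
        exact Perm.SameCycle.refl _ _
      · intro h
        exact h.eq_of_left hx
    · simp only [f, hx, hy, dif_pos, dif_neg, not_false_eq_true, reduceCtorEq, false_iff]
      intro h
      exact hy (h.apply_eq_self_iff.1 hx)
    · simp only [f, hx, hy, dif_pos, dif_neg, not_false_eq_true, reduceCtorEq, false_iff]
      intro h
      exact hx (h.apply_eq_self_iff.2 hy)
    · simp only [f, hx, hy, dif_neg, not_false_eq_true, Sum.inl.injEq, Subtype.mk.injEq]
      exact (Perm.sameCycle_iff_cycleOf_eq_of_mem_support
        (Perm.mem_support.2 hx) (Perm.mem_support.2 hy)).symm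
  let F : Quotient (Perm.SameCycle.setoid σ) →
      {c // c ∈ σ.cycleFactorsFinset} ⊕ {i : Fin n // σ i = i} :=
    Quotient.lift f fun x y h => (key x y).2 h
  have hF : Function.Bijective F := by
    constructor
    · rintro ⟨x⟩ ⟨y⟩ h
      exact Quotient.sound ((key x y).1 h)
    · rintro (⟨c, hc⟩ | ⟨i, hi⟩)
      · obtain ⟨x, hx⟩ := (Perm.mem_cycleFactorsFinset_iff.1 hc).1.nonempty_support
        have hσ : σ x ≠ x :=
          Perm.mem_support.1 (Perm.mem_cycleFactorsFinset_support_le hc hx)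
        refine ⟨Quotient.mk _ x, ?_⟩
        change f x = _
        simp only [f, hσ, dif_neg, not_false_eq_true, Sum.inl.injEq, Subtype.mk.injEq]
        exact (Perm.cycle_is_cycleOf hx hc).symm
      · refine ⟨Quotient.mk _ i, ?_⟩
        change f i = _
        simp only [f, hi, dif_pos]
  rw [Nat.card_congr (Equiv.ofBijective F hF), Nat.card_sum, Nat.card_eq_fintype_card,
    Nat.card_eq_fintype_card, Fintype.card_coe, Fintype.card_subtype, cycleNumber]

open Equiv in
theorem Equiv.Perm.SameCycle.apply_eq_of_invariant {α β : Type*} {σ : Perm α} {g : α → β}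
    (hg : ∀ a, g (σ a) = g a) {a b : α} (h : σ.SameCycle a b) : g a = g b := by
  have hz : ∀ (k : ℕ) (a : α), g ((σ ^ k) a) = g a := by
    intro k
    induction k with
    | zero => simp
    | succ k ih => intro a; rw [pow_succ, Perm.mul_apply, ih, hg]
  obtain ⟨k, rfl⟩ := h
  rcases k with k | k
  · simp [hz]
  · rw [zpow_negSucc]
    simpa using hz (k + 1) ((σ ^ (k + 1))⁻¹ a)

open Equiv in
theorem cycleNumber_decomposeFin_symm_zero {n : ℕ} (e : Perm (Fin n)) :
    cycleNumber (Perm.decomposeFin.symm (0, e)) = cycleNumber e + 1 := by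
  rw [← card_quotient_sameCycle, ← card_quotient_sameCycle]
  set σ : Perm (Fin (n + 1)) := Perm.decomposeFin.symm (0, e) with hσ
  have h0 : σ 0 = 0 := by simp [hσ]
  have hs : ∀ i : Fin n, σ i.succ = (e i).succ := by intro i; simp [hσ]
  let g : Fin (n + 1) → Option (Quotient (Perm.SameCycle.setoid e)) :=
    Fin.cases none fun i => some (Quotient.mk _ i)
  have hg : ∀ a, g (σ a) = g a := by
    refine Fin.cases (by rw [h0]) fun i => ?_
    rw [hs]
    simp only [g, Fin.cases_succ, Option.some.injEq]
    exact Quotient.sound (Perm.sameCycle_apply_left.2 (Perm.SameCycle.refl e i))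
  let f : Fin n → Quotient (Perm.SameCycle.setoid σ) := fun i => Quotient.mk _ i.succ
  have hf : ∀ i, f (e i) = f i := by
    intro i
    refine Quotient.sound ?_
    rw [← hs]
    exact Perm.sameCycle_apply_left.2 (Perm.SameCycle.refl σ _)
  let E : Quotient (Perm.SameCycle.setoid σ) ≃ Option (Quotient (Perm.SameCycle.setoid e)) :=
    { toFun := Quotient.lift g fun a b h => Perm.SameCycle.apply_eq_of_invariant hg h
      invFun := fun o => o.elim (Quotient.mk _ 0)
        (Quotient.lift f fun a b h => Perm.SameCycle.apply_eq_of_invariant hf h)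
      left_inv := by
        rintro ⟨a⟩
        refine Fin.cases ?_ (fun i => ?_) a <;> rfl
      right_inv := by
        rintro (_ | ⟨⟨i⟩⟩) <;> rfl }
  rw [Nat.card_congr E, Finite.card_option]

-- The letter 0 is inserted just before `p` in the cycle of `p`, so the orbits correspond
-- bijectively, 0 going to the class of `p`.
open Equiv in
theorem cycleNumber_decomposeFin_symm_succ {n : ℕ} (e : Perm (Fin n)) (p : Fin n) :
    cycleNumber (Perm.decomposeFin.symm (p.succ, e)) = cycleNumber e := by
  rw [← card_quotient_sameCycle, ← card_quotient_sameCycle]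
  set σ : Perm (Fin (n + 1)) := Perm.decomposeFin.symm (p.succ, e) with hσ
  have h0 : σ 0 = p.succ := by simp [hσ]
  have hp : ∀ i : Fin n, e i = p → σ i.succ = 0 := by rintro i rfl; simp [hσ]
  have hs : ∀ i : Fin n, e i ≠ p → σ i.succ = (e i).succ := by
    intro i hi
    simp only [hσ, Perm.decomposeFin_symm_apply_succ]
    exact swap_apply_of_ne_of_ne (Fin.succ_ne_zero _) (by simpa using hi)
  let g : Fin (n + 1) → Quotient (Perm.SameCycle.setoid e) :=
    Fin.cases (Quotient.mk _ p) fun i => Quotient.mk _ i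
  have he : ∀ i, (Quotient.mk (Perm.SameCycle.setoid e) (e i)) = Quotient.mk _ i := fun i =>
    Quotient.sound (Perm.sameCycle_apply_left.2 (Perm.SameCycle.refl e i))
  have hg : ∀ a, g (σ a) = g a := by
    refine Fin.cases (by rw [h0]; rfl) fun i => ?_
    by_cases hi : e i = p
    · rw [hp i hi]
      simp only [g, Fin.cases_succ, Fin.cases_zero, ← hi]
      exact he i
    · rw [hs i hi]
      exact he i
  let f : Fin n → Quotient (Perm.SameCycle.setoid σ) := fun i => Quotient.mk _ i.succ
  have hσq : ∀ i, (Quotient.mk (Perm.SameCycle.setoid σ) (σ i)) = Quotient.mk _ i := fun i =>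
    Quotient.sound (Perm.sameCycle_apply_left.2 (Perm.SameCycle.refl σ i))
  have hf : ∀ i, f (e i) = f i := by
    intro i
    by_cases hi : e i = p
    · change Quotient.mk _ (e i).succ = Quotient.mk _ i.succ
      rw [← hσq i.succ, hp i hi, hi, ← h0]
      exact hσq 0
    · change Quotient.mk _ (e i).succ = Quotient.mk _ i.succ
      rw [← hσq i.succ, hs i hi]
  let E : Quotient (Perm.SameCycle.setoid σ) ≃ Quotient (Perm.SameCycle.setoid e) :=
    { toFun := Quotient.lift g fun a b h => Perm.SameCycle.apply_eq_of_invariant hg h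
      invFun := Quotient.lift f fun a b h => Perm.SameCycle.apply_eq_of_invariant hf h
      left_inv := by
        rintro ⟨a⟩
        refine Fin.cases ?_ (fun i => ?_) a
        · change Quotient.mk _ p.succ = Quotient.mk _ 0
          rw [← h0]
          exact hσq 0
        · rfl
      right_inv := by
        rintro ⟨i⟩
        rfl }
  rw [Nat.card_congr E]

/-! ### Excedances and the recurrence -/

theorem excedances_eq_sum {n : ℕ} (π : Equiv.Perm (Fin n)) :
    excedances π = ∑ i, if i < π i then 1 else 0 := by
  rw [excedances, Finset.card_filter]

open Equiv in
theorem excedances_decomposeFin_symm_zero {n : ℕ} (e : Perm (Fin n)) :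
    excedances (Perm.decomposeFin.symm (0, e)) = excedances e := by
  rw [excedances_eq_sum, excedances_eq_sum, Fin.sum_univ_succ]
  simp

-- Here 0 is inserted between `j` and `e j`: 0 becomes an excedance, while `j`, now sent to 0, loses
-- the excedance it may have had.
open Equiv in
theorem excedances_decomposeFin_symm_succ {n : ℕ} (e : Perm (Fin n)) (j : Fin n) :
    excedances (Perm.decomposeFin.symm ((e j).succ, e)) =
      excedances e + if j < e j then 0 else 1 := by
  rw [excedances_eq_sum, excedances_eq_sum, Fin.sum_univ_succ,
    ← Finset.add_sum_erase _ _ (Finset.mem_univ j),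
    ← Finset.add_sum_erase Finset.univ (fun i => if i < e i then 1 else 0) (Finset.mem_univ j)]
  have h : ∀ i ∈ Finset.univ.erase j,
      (if i.succ < (Perm.decomposeFin.symm ((e j).succ, e)) i.succ then 1 else 0) =
        if i < e i then 1 else 0 := by
    intro i hi
    have hij : i ≠ j := Finset.ne_of_mem_erase hi
    rw [Perm.decomposeFin_symm_apply_succ, swap_apply_of_ne_of_ne (Fin.succ_ne_zero _)
      (by simpa using hij)]
    simp
  rw [Finset.sum_congr rfl h]
  simp only [Perm.decomposeFin_symm_apply_zero, Perm.decomposeFin_symm_apply_succ,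
    swap_apply_right, Fin.succ_pos, if_true, Fin.not_lt_zero, if_false]
  split_ifs <;> omega

theorem sum_X_pow_excedances {n : ℕ} (e : Equiv.Perm (Fin n)) :
    ∑ j : Fin n, (X : ℝ[X]) ^ (excedances e + if j < e j then 0 else 1 : ℕ) =
      (excedances e : ℝ[X]) * X ^ excedances e +
        ((n : ℝ[X]) - (excedances e : ℝ[X])) * X ^ (excedances e + 1) := by
  have hsum : ((excedances e : ℕ) : ℝ[X]) = ∑ i, if i < e i then (1 : ℝ[X]) else 0 := by
    rw [excedances_eq_sum]
    push_cast
    rfl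
  have hn : (n : ℝ[X]) = ∑ i : Fin n, 1 := by simp
  have h : ∀ j : Fin n, (X : ℝ[X]) ^ (excedances e + if j < e j then 0 else 1 : ℕ) =
      (if j < e j then (1 : ℝ[X]) else 0) * X ^ excedances e +
        (1 - if j < e j then (1 : ℝ[X]) else 0) * X ^ (excedances e + 1) := by
    intro j
    split_ifs <;> simp
  rw [Finset.sum_congr rfl fun j _ => h j, Finset.sum_add_distrib, ← Finset.sum_mul,
    ← Finset.sum_mul, Finset.sum_sub_distrib, ← hsum, ← hn]

theorem qEulerian_zero (q : ℝ) : qEulerian 0 q = 1 := by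
  simp [qEulerian, cycleNumber, excedances]

/-- Each `e` has one extension fixing 0, worth a factor q, and n others: exc(e) of them keep the
exponent and n - exc(e) raise it by one. The weight exc(e) is what x d/dx produces. -/
theorem qEulerian_succ (n : ℕ) (q : ℝ) :
    qEulerian (n + 1) q =
      ((n : ℝ[X]) * X + C q) * qEulerian n q + X * (1 - X) * derivative (qEulerian n q) := by
  have h : ∀ e : Equiv.Perm (Fin n),
      ∑ p, C (q ^ cycleNumber (Equiv.Perm.decomposeFin.symm (p, e))) *
        (X : ℝ[X]) ^ excedances (Equiv.Perm.decomposeFin.symm (p, e)) =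
      ((n : ℝ[X]) * X + C q) * (C (q ^ cycleNumber e) * X ^ excedances e) +
        X * (1 - X) * derivative (C (q ^ cycleNumber e) * X ^ excedances e) := by
    intro e
    rw [Fin.sum_univ_succ, cycleNumber_decomposeFin_symm_zero,
      excedances_decomposeFin_symm_zero, ← Equiv.sum_comp e]
    simp only [cycleNumber_decomposeFin_symm_succ, excedances_decomposeFin_symm_succ]
    rw [← Finset.mul_sum, sum_X_pow_excedances, derivative_C_mul, derivative_X_pow]
    have hX : (C (excedances e : ℝ) : ℝ[X]) * X ^ (excedances e - 1) * X =
        (excedances e : ℝ[X]) * X ^ excedances e := by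
      rcases excedances e with _ | k
      · simp
      · simp [pow_succ, mul_assoc]
    rw [pow_succ q, C_mul]
    linear_combination (-(1 - X) * C (q ^ cycleNumber e)) * hX
  rw [qEulerian, ← Equiv.sum_comp Equiv.Perm.decomposeFin.symm, Fintype.sum_prod_type_right,
    Finset.sum_congr rfl fun e _ => h e, Finset.sum_add_distrib, ← Finset.mul_sum,
    ← Finset.mul_sum, ← derivative_sum, qEulerian]

/-! ### Real-rootedness and partial fractions -/

theorem aeval_coe_complex (p : ℝ[X]) (x : ℝ) : aeval (x : ℂ) p = ((p.eval x : ℝ) : ℂ) := by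
  have := aeval_algebraMap_apply ℂ x p
  rwa [Complex.coe_algebraMap, coe_aeval_eq_eval] at this

theorem RZ.ne_zero {p : ℝ[X]} {I : Set ℝ} (h : RZ p I) : p ≠ 0 := by
  rintro rfl
  obtain ⟨x, -, hx⟩ := h Complex.I (by simp)
  simpa using congrArg Complex.im hx

theorem RZ.mem_of_mem_roots {p : ℝ[X]} {I : Set ℝ} (h : RZ p I) {r : ℝ} (hr : r ∈ p.roots) :
    r ∈ I := by
  have h0 : aeval (r : ℂ) p = 0 := by
    rw [aeval_coe_complex, (isRoot_of_mem_roots hr).eq_zero, Complex.ofReal_zero]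
  obtain ⟨x, hx, hxr⟩ := h _ h0
  rwa [Complex.ofReal_injective hxr]

theorem RZ.splits {p : ℝ[X]} {I : Set ℝ} (h : RZ p I) : p.Splits := by
  refine Splits.of_splits_map (algebraMap ℝ ℂ) (IsAlgClosed.splits _) fun z hz => ?_
  have hz0 : aeval z p = 0 := by
    have := isRoot_of_mem_roots hz
    rwa [IsRoot.def, eval_map_algebraMap] at this
  obtain ⟨x, -, rfl⟩ := h z hz0
  exact ⟨x, rfl⟩

theorem RZ.of_forall_aeval {p : ℝ[X]} {I J : Set ℝ} (h : RZ p I)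
    (hIJ : ∀ x : ℝ, x ∈ I → p.eval x = 0 → x ∈ J) : RZ p J := by
  intro z hz
  obtain ⟨x, hx, rfl⟩ := h z hz
  refine ⟨x, hIJ x hx ?_, rfl⟩
  rw [aeval_coe_complex] at hz
  exact_mod_cast hz

/-- Logarithmic derivative of a split real polynomial, normalised at `c`. -/
theorem Polynomial.Splits.sub_mul_aeval_derivative {p : ℝ[X]} (hp : p.Splits) (c : ℝ) {z : ℂ}
    (hz : aeval z p ≠ 0) :
    (z - c) * aeval z (derivative p) =
      aeval z p * (p.natDegree + (p.roots.map fun r : ℝ => ((r : ℂ) - c) / (z - r)).sum) := by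
  have hev : ∀ f : ℝ[X], (f.map (algebraMap ℝ ℂ)).eval z = aeval z f := fun f =>
    eval_map_algebraMap f z
  have h := (hp.map (algebraMap ℝ ℂ)).eval_derivative_eq_eval_mul_sum (x := z) (by rwa [hev])
  rw [derivative_map, hev, hev, hp.roots_map, Multiset.map_map] at h
  have hne : ∀ r ∈ p.roots, z - (r : ℂ) ≠ 0 := by
    intro r hr h0
    apply hz
    rw [sub_eq_zero.1 h0]
    rw [aeval_coe_complex, (isRoot_of_mem_roots hr).eq_zero, Complex.ofReal_zero]
  rw [h, hp.natDegree_eq_card_roots]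
  have key : ∀ s : Multiset ℝ, (∀ r ∈ s, z - (r : ℂ) ≠ 0) →
      (z - c) * (s.map ((fun w => 1 / (z - w)) ∘ (algebraMap ℝ ℂ))).sum =
        s.card + (s.map fun r : ℝ => ((r : ℂ) - c) / (z - r)).sum := by
    intro s
    induction s using Multiset.induction_on with
    | empty => simp
    | cons r s ih =>
      intro hs
      have h1 := hs r (Multiset.mem_cons_self r s)
      have h2 := ih fun x hx => hs x (Multiset.mem_cons_of_mem hx)
      rw [Multiset.map_cons, Multiset.sum_cons, mul_add, h2, Multiset.map_cons,
        Multiset.sum_cons, Multiset.card_cons]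
      simp only [Function.comp_apply, Complex.coe_algebraMap]
      field_simp
      push_cast
      ring
  rw [mul_left_comm, key _ hne]

/-- A partial fraction with poles `t.2` and nonnegative residues `t.1` maps the open upper half
plane to the open lower one, unless it vanishes. -/
theorem partialFraction_eq_zero_or_im_mul_im_neg {s : Multiset (ℝ × ℝ)} (hs : ∀ t ∈ s, 0 ≤ t.1)
    {z : ℂ} (hz : z.im ≠ 0) :
    (s.map fun t => (t.1 : ℂ) / (z - t.2)).sum = 0 ∨
      (s.map fun t => (t.1 : ℂ) / (z - t.2)).sum.im * z.im < 0 := by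
  induction s using Multiset.induction_on with
  | empty => simp
  | cons t s ih =>
    have h2 := ih fun x hx => hs x (Multiset.mem_cons_of_mem hx)
    rw [Multiset.map_cons, Multiset.sum_cons]
    have ht : (t.1 : ℂ) / (z - t.2) = 0 ∨ ((t.1 : ℂ) / (z - t.2)).im * z.im < 0 := by
      rcases (hs t (Multiset.mem_cons_self t s)).eq_or_lt with h0 | h0
      · left
        simp [← h0]
      · right
        have hpos : 0 < Complex.normSq (z - t.2) := by
          rw [Complex.normSq_pos]
          intro h
          apply hz
          simpa using congrArg Complex.im h
        have him : ((t.1 : ℂ) / (z - t.2)).im = -(t.1 * z.im / Complex.normSq (z - t.2)) := by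
          rw [Complex.div_im]
          simp
        rw [him]
        have : 0 < t.1 * z.im ^ 2 / Complex.normSq (z - t.2) := by positivity
        calc -(t.1 * z.im / Complex.normSq (z - t.2)) * z.im
            = -(t.1 * z.im ^ 2 / Complex.normSq (z - t.2)) := by ring
          _ < 0 := by linarith
    rcases ht with h | h <;> rcases h2 with h' | h'
    · simp [h, h']
    · right; simpa [h] using h'
    · right; simpa [h'] using h
    · right
      rw [Complex.add_im, add_mul]
      linarith

theorem im_eq_zero_of_partialFraction_eq {s : Multiset (ℝ × ℝ)} (hs : ∀ t ∈ s, 0 ≤ t.1)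
    {z : ℂ} {c : ℝ} (hc : c ≠ 0) (h : (s.map fun t => (t.1 : ℂ) / (z - t.2)).sum = c) :
    z.im = 0 := by
  by_contra hz
  rcases partialFraction_eq_zero_or_im_mul_im_neg hs hz with h' | h'
  · rw [h] at h'
    exact hc (by exact_mod_cast h')
  · rw [h] at h'
    simp at h'

theorem lt_of_partialFraction_eq_of_pos {s : Multiset (ℝ × ℝ)} {L : ℝ}
    (hs : ∀ t ∈ s, 0 ≤ t.1 ∧ L ≤ t.2) {z : ℂ} {c : ℝ} (hc : 0 < c)
    (h : (s.map fun t => (t.1 : ℂ) / (z - t.2)).sum = c) : ∃ x ∈ Set.Ioi L, z = (x : ℂ) := by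
  have hz := im_eq_zero_of_partialFraction_eq (fun t ht => (hs t ht).1) hc.ne' h
  have hzx : z = (z.re : ℂ) := by apply Complex.ext <;> simp [hz]
  refine ⟨z.re, ?_, hzx⟩
  by_contra hx
  rw [Set.mem_Ioi, not_lt] at hx
  have h1 : (s.map fun t => t.1 / (z.re - t.2)).sum = c := by
    apply Complex.ofReal_injective
    rw [← h, ← Complex.coe_algebraMap, map_multiset_sum, Multiset.map_map]
    congr 1
    refine Multiset.map_congr rfl fun t _ => ?_
    rw [hzx]
    simp
  have h2 : (s.map fun t => t.1 / (z.re - t.2)).sum ≤ 0 := by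
    have := Multiset.sum_map_le_sum_map (s := s) (fun t => t.1 / (z.re - t.2)) (fun _ => (0 : ℝ))
      fun t ht => div_nonpos_of_nonneg_of_nonpos (hs t ht).1 (by linarith [(hs t ht).2])
    simpa using this
  linarith

theorem lt_of_partialFraction_eq_of_neg {s : Multiset (ℝ × ℝ)} {L : ℝ}
    (hs : ∀ t ∈ s, 0 ≤ t.1 ∧ t.2 ≤ L) {z : ℂ} {c : ℝ} (hc : c < 0)
    (h : (s.map fun t => (t.1 : ℂ) / (z - t.2)).sum = c) : ∃ x ∈ Set.Iio L, z = (x : ℂ) := by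
  -- The reflection z ↦ -z reduces this to the case of a positive constant.
  have h' : ((s.map fun t => (t.1, -t.2)).map fun t : ℝ × ℝ => (t.1 : ℂ) / (-z - t.2)).sum =
      ((-c : ℝ) : ℂ) := by
    rw [Complex.ofReal_neg, ← h, Multiset.map_map, ← Multiset.sum_map_neg', Multiset.map_map]
    congr 1
    refine Multiset.map_congr rfl fun t _ => ?_
    simp only [Function.comp_apply, Complex.ofReal_neg]
    rw [← div_neg]
    congr 1
    ring
  obtain ⟨x, hx, hzx⟩ := lt_of_partialFraction_eq_of_pos (L := -L) (by
    intro t ht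
    obtain ⟨u, hu, rfl⟩ := Multiset.mem_map.1 ht
    exact ⟨(hs u hu).1, neg_le_neg (hs u hu).2⟩) (neg_pos.2 hc) h'
  refine ⟨-x, ?_, ?_⟩
  · simp only [Set.mem_Ioi, Set.mem_Iio] at hx ⊢
    linarith
  · rw [Complex.ofReal_neg, ← hzx, neg_neg]

/-- A Laguerre type inequality: the numerator of the derivative of `(x - 1) p' / p`. -/
theorem Polynomial.Splits.laguerre_nonneg {p : ℝ[X]} (hp : p.Splits) (h1 : ∀ r ∈ p.roots, r ≤ 1)
    (x : ℝ) :
    0 ≤ p.eval x * (derivative p).eval x + (1 - x) *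
      ((derivative p).eval x ^ 2 - p.eval x * (derivative (derivative p)).eval x) := by
  have key : ∀ s : Multiset ℝ, (∀ r ∈ s, r ≤ 1) → ∀ a : ℝ, ∀ f : ℝ[X],
      f = C a * (s.map fun r => X - C r).prod →
      0 ≤ f.eval x * (derivative f).eval x + (1 - x) *
        ((derivative f).eval x ^ 2 - f.eval x * (derivative (derivative f)).eval x) := by
    intro s
    induction s using Multiset.induction_on with
    | empty =>
      rintro - a f rfl
      simp
    | cons r s ih =>
      intro hs a f hf
      have hr := hs r (Multiset.mem_cons_self r s)
      have h2 := ih (fun x hx => hs x (Multiset.mem_cons_of_mem hx)) a _ rfl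
      set g := C a * (s.map fun r => X - C r).prod with hg
      have hfg : f = (X - C r) * g := by
        rw [hf, Multiset.map_cons, Multiset.prod_cons, hg]
        ring
      have e0 : f.eval x = (x - r) * g.eval x := by simp [hfg]
      have e1 : (derivative f).eval x = g.eval x + (x - r) * (derivative g).eval x := by
        simp [hfg]
      have e2 : (derivative (derivative f)).eval x =
          2 * (derivative g).eval x + (x - r) * (derivative (derivative g)).eval x := by
        simp [hfg]
        ring
      rw [e0, e1, e2]
      -- With E(f) the expression in question, E((X - r) g) = (x - r)² E(g) + (1 - r) g².
      have h3 : 0 ≤ (1 - r) * g.eval x ^ 2 := mul_nonneg (by linarith) (sq_nonneg _)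
      have h4 := mul_nonneg (sq_nonneg (x - r)) h2
      linarith
  exact key _ h1 _ p hp.eq_prod_roots

/-! ### Degree bound and values at 0 and 1 -/

theorem qEulerian_one (q : ℝ) : qEulerian 1 q = C q := by
  simpa [qEulerian_zero] using qEulerian_succ 0 q

theorem natDegree_qEulerian_succ_le (n : ℕ) (q : ℝ) : (qEulerian (n + 1) q).natDegree ≤ n := by
  induction n with
  | zero => simp [qEulerian_one]
  | succ n ih =>
    rw [qEulerian_succ]
    have hd : (derivative (qEulerian (n + 1) q)).natDegree ≤ n - 1 :=
      (natDegree_derivative_le _).trans (Nat.sub_le_sub_right ih 1)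
    have h1 : (((n + 1 : ℕ) : ℝ[X]) * X + C q).natDegree ≤ 1 := by compute_degree
    have h2 : (X * (1 - X) : ℝ[X]).natDegree ≤ 2 := by compute_degree
    refine natDegree_add_le_of_degree_le ?_ ?_
    · exact natDegree_mul_le.trans (by omega)
    · rcases n with _ | n
      · have : derivative (qEulerian (0 + 1) q) = 0 := by simp [qEulerian_one]
        rw [this]
        simp
      · exact natDegree_mul_le.trans (by omega)

theorem eval_zero_qEulerian (n : ℕ) (q : ℝ) : (qEulerian n q).eval 0 = q ^ n := by
  induction n with
  | zero => simp [qEulerian_zero]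
  | succ n ih =>
    rw [qEulerian_succ]
    simp [ih, pow_succ']

theorem eval_one_qEulerian_succ (n : ℕ) (q : ℝ) :
    (qEulerian (n + 1) q).eval 1 = (n + q) * (qEulerian n q).eval 1 := by
  rw [qEulerian_succ]
  simp

theorem aeval_qEulerian_succ (n : ℕ) (q : ℝ) (z : ℂ) :
    aeval z (qEulerian (n + 1) q) = (n * z + q) * aeval z (qEulerian n q) +
      z * (1 - z) * aeval z (derivative (qEulerian n q)) := by
  rw [qEulerian_succ]
  simp

theorem eval_one_qEulerian_pos (n : ℕ) {q : ℝ} (hq : 0 < q) : 0 < (qEulerian n q).eval 1 := by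
  induction n with
  | zero => simp [qEulerian_zero]
  | succ n ih =>
    rw [eval_one_qEulerian_succ]
    positivity

/-- The value is q(q + 1)⋯(q + n - 1), with every factor negative. -/
theorem eval_one_qEulerian_ne_zero {n : ℕ} {q : ℝ} (h : (n : ℝ) + q < 1) :
    (qEulerian n q).eval 1 ≠ 0 := by
  induction n with
  | zero => simp [qEulerian_zero]
  | succ n ih =>
    rw [eval_one_qEulerian_succ]
    push_cast at h
    exact mul_ne_zero (by linarith) (ih (by linarith))

theorem RZ_C {a : ℝ} (ha : a ≠ 0) (I : Set ℝ) : RZ (C a) I := by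
  intro z hz
  simp [ha] at hz

/-! ### Positive q -/

/-- Both claims must be proved together: at a common zero of consecutive polynomials the recurrence
leaves only x(1 - x) A_n', which simplicity rules out. -/
theorem qEulerian_succ_zeros_of_pos (n : ℕ) {q : ℝ} (hq : 0 < q) :
    RZ (qEulerian (n + 1) q) (Set.Iio 0) ∧ ∀ x : ℝ, (qEulerian (n + 1) q).eval x = 0 →
      (derivative (qEulerian (n + 1) q)).eval x ≠ 0 := by
  induction n with
  | zero =>
    rw [zero_add, qEulerian_one]
    exact ⟨RZ_C hq.ne' _, fun x hx => by simp [hq.ne'] at hx⟩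
  | succ n ih =>
    obtain ⟨hRZ, hsimple⟩ := ih
    have hdeg := natDegree_qEulerian_succ_le n q
    have h1 := eval_one_qEulerian_pos (n + 1 + 1) hq
    have h00 := eval_zero_qEulerian (n + 1 + 1) q
    have hrec := qEulerian_succ (n + 1) q
    have harec := aeval_qEulerian_succ (n + 1) q
    set p := qEulerian (n + 1) q
    set P := qEulerian (n + 1 + 1) q
    have hd : (p.natDegree : ℝ) ≤ n := by exact_mod_cast hdeg
    have hroot : ∀ r ∈ p.roots, r < 0 := fun r hr => hRZ.mem_of_mem_roots hr
    have hne : ∀ z : ℂ, aeval z P = 0 → z ≠ 0 ∧ z ≠ 1 ∧ aeval z p ≠ 0 := by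
      intro z hz
      have hz0 : z ≠ 0 := by
        rintro rfl
        have := aeval_coe_complex P 0
        rw [Complex.ofReal_zero, hz, h00] at this
        exact (pow_pos hq _).ne' (by exact_mod_cast this.symm)
      have hz1 : z ≠ 1 := by
        rintro rfl
        have := aeval_coe_complex P 1
        rw [Complex.ofReal_one, hz] at this
        exact h1.ne' (by exact_mod_cast this.symm)
      refine ⟨hz0, hz1, fun hpz => ?_⟩
      obtain ⟨x, -, rfl⟩ := hRZ z hpz
      rw [harec, hpz, mul_zero, zero_add] at hz
      rw [aeval_coe_complex] at hpz hz
      refine hsimple x (by exact_mod_cast hpz) ?_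
      rcases mul_eq_zero.1 hz with h | h
      · rcases mul_eq_zero.1 h with h | h
        · exact absurd h hz0
        · exact absurd (sub_eq_zero.1 h).symm hz1
      · exact_mod_cast h
    have hRZ' : RZ P (Set.Iio 0) := by
      intro z hz
      obtain ⟨hz0, hz1, hpz⟩ := hne z hz
      have hlog := hRZ.splits.sub_mul_aeval_derivative 1 hpz
      -- Dividing the recurrence by z p(z) gives q/z + ∑ (1 - r)/(z - r) = -(n + 1 - deg p), which
      -- is negative as deg p ≤ n.
      refine lt_of_partialFraction_eq_of_neg (c := -((n + 1 : ℕ) - p.natDegree : ℝ))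
        (s := (q, 0) ::ₘ p.roots.map fun r => (1 - r, r)) ?_ (by push_cast; linarith) ?_
      · intro t ht
        rcases Multiset.mem_cons.1 ht with rfl | ht
        · exact ⟨hq.le, le_rfl⟩
        · obtain ⟨r, hr, rfl⟩ := Multiset.mem_map.1 ht
          have := hroot r hr
          exact ⟨by dsimp only; linarith, this.le⟩
      · rw [Multiset.map_cons, Multiset.sum_cons, Multiset.map_map]
        have hneg : (p.roots.map ((fun t : ℝ × ℝ => (t.1 : ℂ) / (z - t.2)) ∘
            fun r => (1 - r, r))).sum =
            -(p.roots.map fun r : ℝ => ((r : ℂ) - (1 : ℝ)) / (z - r)).sum := by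
          rw [← Multiset.sum_map_neg', Multiset.map_map]
          congr 1
          refine Multiset.map_congr rfl fun r _ => ?_
          simp only [Function.comp_apply, ← neg_div]
          push_cast
          ring
        rw [hneg]
        set T := (p.roots.map fun r : ℝ => ((r : ℂ) - (1 : ℝ)) / (z - r)).sum
        rw [harec] at hz
        have hmul : aeval z p * (((n + 1 : ℕ) : ℂ) * z + q - z * (p.natDegree + T)) = 0 := by
          push_cast at hlog hz ⊢
          linear_combination hz + z * hlog
        have hzero := (mul_eq_zero.1 hmul).resolve_left hpz
        push_cast at hzero ⊢
        rw [sub_zero]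
        field_simp
        linear_combination hzero
    refine ⟨hRZ', fun x hx hx' => ?_⟩
    have hxz : aeval (x : ℂ) P = 0 := by rw [aeval_coe_complex, hx, Complex.ofReal_zero]
    obtain ⟨y, hy, hxy⟩ := hRZ' x hxz
    obtain rfl := Complex.ofReal_injective hxy
    rw [Set.mem_Iio] at hy
    have hpx : p.eval x ≠ 0 := by
      have := (hne x hxz).2.2
      rw [aeval_coe_complex] at this
      exact_mod_cast this
    have hL := hRZ.splits.laguerre_nonneg (fun r hr => by linarith [hroot r hr]) x
    rw [hrec] at hx hx'
    simp only [derivative_add, derivative_mul, derivative_X, derivative_C, derivative_natCast,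
      derivative_sub, derivative_one, eval_add, eval_mul, eval_sub, eval_X, eval_C, eval_natCast,
      eval_one, eval_neg, zero_mul, zero_add, add_zero, mul_one, one_mul, zero_sub, mul_neg]
      at hx hx'
    set a := p.eval x
    set b := (derivative p).eval x
    set c := (derivative (derivative p)).eval x
    -- P/(xp) = n + 1 + q/x - (x - 1)p'/p would have zero derivative at a double zero of P, but that
    -- derivative is -q/x² minus a nonnegative Laguerre term.
    have hcert : x ^ 2 * (1 - x) * (a * b + (1 - x) * (b ^ 2 - a * c)) =
        -((1 - x) * q * a ^ 2) := by
      linear_combination (x * (1 - x) * b + (1 - x) * a) * hx - x * (1 - x) * a * hx'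
    have h3 : 0 ≤ x ^ 2 * (1 - x) * (a * b + (1 - x) * (b ^ 2 - a * c)) :=
      mul_nonneg (mul_nonneg (sq_nonneg x) (by linarith)) hL
    have h4 : 0 < (1 - x) * q * a ^ 2 :=
      mul_pos (mul_pos (by linarith) hq) (by positivity)
    linarith

/-! ### The range n + q ≤ 0 -/

theorem RZ_qEulerian_succ_of_nonpos {n : ℕ} {q : ℝ} (h : (n : ℝ) + q ≤ 0) (hq : q ≠ 0) :
    RZ (qEulerian (n + 1) q) (Set.Ici 1) := by
  induction n with
  | zero =>
    rw [zero_add, qEulerian_one]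
    exact RZ_C hq _
  | succ n ih =>
    push_cast at h
    have hRZ := ih (by linarith)
    have hdeg := natDegree_qEulerian_succ_le n q
    have harec := aeval_qEulerian_succ (n + 1) q
    set p := qEulerian (n + 1) q
    have hd : (p.natDegree : ℝ) ≤ n := by exact_mod_cast hdeg
    have hroot : ∀ r ∈ p.roots, 1 ≤ r := fun r hr => hRZ.mem_of_mem_roots hr
    intro z hz
    by_cases hz1 : z = 1
    · exact ⟨1, Set.self_mem_Ici, by simpa using hz1⟩
    by_cases hpz : aeval z p = 0
    · exact hRZ z hpz
    have hz1' : z - 1 ≠ 0 := sub_ne_zero.2 hz1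
    have hlog := hRZ.splits.sub_mul_aeval_derivative 0 hpz
    obtain ⟨x, hx, hzx⟩ : ∃ x ∈ Set.Ioi (1 : ℝ), z = (x : ℂ) := by
      -- Dividing by (z - 1) p(z) instead yields a pole at 1 with residue -(n + 1 + q) ≥ 0.
      refine lt_of_partialFraction_eq_of_pos (c := ((n + 1 : ℕ) - p.natDegree : ℝ))
        (s := (-(n + 1 + q), 1) ::ₘ p.roots.map fun r => (r, r)) ?_ (by push_cast; linarith) ?_
      · intro t ht
        rcases Multiset.mem_cons.1 ht with rfl | ht
        · exact ⟨by dsimp only; linarith, le_rfl⟩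
        · obtain ⟨r, hr, rfl⟩ := Multiset.mem_map.1 ht
          have := hroot r hr
          exact ⟨by dsimp only; linarith, this⟩
      · rw [Multiset.map_cons, Multiset.sum_cons, Multiset.map_map]
        simp only [Complex.ofReal_zero, sub_zero] at hlog
        simp only [Function.comp_def]
        set T := (p.roots.map fun r : ℝ => (r : ℂ) / (z - r)).sum
        rw [harec] at hz
        have hmul : aeval z p * (((n + 1 : ℕ) : ℂ) * z + q + (1 - z) * (p.natDegree + T)) = 0 := by
          linear_combination hz - (1 - z) * hlog
        have hzero := (mul_eq_zero.1 hmul).resolve_left hpz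
        push_cast at hzero ⊢
        field_simp
        linear_combination -hzero
    exact ⟨x, Set.Ioi_subset_Ici_self hx, hzx⟩

/-! ### Negative integers q -/

/-- At a zero z of the new polynomial with p(z) ≠ 0, ∑ r/(z - r) = k - deg p > 0. -/
theorem RZ_Ioi_one_sub_X_mul_derivative {p : ℝ[X]} {k : ℝ} (hp : RZ p (Set.Ioi 1))
    (hk : (p.natDegree : ℝ) < k) : RZ (C k * p - X * derivative p) (Set.Ioi 1) := by
  intro z hz
  by_cases hpz : aeval z p = 0
  · exact hp z hpz
  have hlog := hp.splits.sub_mul_aeval_derivative 0 hpz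
  refine lt_of_partialFraction_eq_of_pos (c := k - p.natDegree)
    (s := p.roots.map fun r => (r, r)) ?_ (by linarith) ?_
  · intro t ht
    obtain ⟨r, hr, rfl⟩ := Multiset.mem_map.1 ht
    have : 1 < r := hp.mem_of_mem_roots hr
    exact ⟨by dsimp only; linarith, this.le⟩
  · rw [Multiset.map_map]
    simp only [Complex.ofReal_zero, sub_zero] at hlog
    simp only [Function.comp_def]
    set T := (p.roots.map fun r : ℝ => (r : ℂ) / (z - r)).sum
    have hz' : (k : ℂ) * aeval z p - z * aeval z (derivative p) = 0 := by
      simpa using hz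
    have hmul : aeval z p * (k - (p.natDegree + T)) = 0 := by
      linear_combination hz' + hlog
    have hzero := (mul_eq_zero.1 hmul).resolve_left hpz
    push_cast
    linear_combination -hzero

theorem RZ_qEulerian_Ioi_one {n : ℕ} {q : ℝ} (h : (n : ℝ) + q ≤ 0) (hq : q < 0) :
    RZ (qEulerian n q) (Set.Ioi 1) := by
  have hle : RZ (qEulerian n q) (Set.Ici 1) := by
    rcases n with _ | n
    · rw [qEulerian_zero, ← C_1]
      exact RZ_C one_ne_zero _
    · push_cast at h
      exact RZ_qEulerian_succ_of_nonpos (by linarith) hq.ne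
  refine hle.of_forall_aeval fun x hx hx0 => Set.mem_Ioi.2 (lt_of_le_of_ne hx ?_)
  rintro rfl
  exact eval_one_qEulerian_ne_zero (by linarith) hx0

/-- For `q = -(k + 1)` the polynomial splits off the power `(X - 1) ^ (n + q)`. -/
theorem exists_qEulerian_neg_eq_mul (k j : ℕ) :
    ∃ p : ℝ[X], qEulerian (k + 1 + j) (-(k + 1)) = (X - 1) ^ j * p ∧ RZ p (Set.Ioi 1) ∧
      p.natDegree ≤ k := by
  induction j with
  | zero =>
    refine ⟨_, (by rw [pow_zero, one_mul]), ?_, natDegree_qEulerian_succ_le k _⟩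
    exact RZ_qEulerian_Ioi_one (by push_cast; linarith) (by linarith [k.cast_nonneg (α := ℝ)])
  | succ j ih =>
    obtain ⟨p, hp, hRZ, hdeg⟩ := ih
    have hk : (p.natDegree : ℝ) < k + 1 := by exact_mod_cast Nat.lt_succ_of_le hdeg
    -- This is the recurrence divided by (X - 1)^(j + 1): since n = k + 1 + j, the coefficient of p
    -- becomes nX - (k + 1) - jX = (k + 1)(X - 1).
    refine ⟨C ((k : ℝ) + 1) * p - X * derivative p, ?_,
      RZ_Ioi_one_sub_X_mul_derivative hRZ hk, ?_⟩
    · rw [← add_assoc, qEulerian_succ, hp]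
      have hX : (j : ℝ[X]) * (X - 1) ^ (j - 1) * (X - 1) = (j : ℝ[X]) * (X - 1) ^ j := by
        rcases j with _ | j
        · simp
        · simp [pow_succ, mul_assoc]
      have hder : derivative ((X - 1 : ℝ[X]) ^ j) = (j : ℝ[X]) * (X - 1) ^ (j - 1) := by
        rw [derivative_pow]
        simp
      rw [derivative_mul, hder]
      simp only [map_neg, map_add, map_natCast, map_one, pow_succ]
      push_cast
      linear_combination -X * p * hX
    · refine (natDegree_sub_le _ _).trans (max_le ((natDegree_C_mul_le _ _).trans hdeg) ?_)
      rcases Nat.eq_zero_or_pos p.natDegree with h0 | h0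
      · rw [derivative_of_natDegree_zero h0]
        simp
      · refine natDegree_mul_le.trans ?_
        have := natDegree_derivative_lt h0.ne'
        rw [natDegree_X]
        omega

theorem qEulerian_neg_one (n : ℕ) : qEulerian (n + 1) (-1) = -(X - 1) ^ n := by
  induction n with
  | zero => simp [qEulerian_one]
  | succ n ih =>
    rw [qEulerian_succ, ih, derivative_neg, derivative_pow]
    have hX : (n : ℝ[X]) * (X - 1) ^ (n - 1) * (X - 1) = (n : ℝ[X]) * (X - 1) ^ n := by
      rcases n with _ | n
      · simp
      · simp [pow_succ, mul_assoc]
    simp only [map_neg, map_natCast, map_one, derivative_sub, derivative_X, derivative_one,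
      pow_succ]
    push_cast
    linear_combination X * hX

theorem eval_one_ne_zero_of_RZ_Ioi {p : ℝ[X]} (hp : RZ p (Set.Ioi 1)) : p.eval 1 ≠ 0 := by
  intro h
  obtain ⟨x, hx, h1⟩ := hp ((1 : ℝ) : ℂ) (by rw [aeval_coe_complex, h, Complex.ofReal_zero])
  rw [← Complex.ofReal_injective h1] at hx
  exact Set.self_notMem_Ioi hx

theorem not_X_sub_one_pow_succ_dvd {p : ℝ[X]} (hp : p.eval 1 ≠ 0) (j : ℕ) :
    ¬ (X - 1) ^ (j + 1) ∣ (X - 1) ^ j * p := by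
  have hne : (X - 1 : ℝ[X]) ≠ 0 := by simpa using X_sub_C_ne_zero (1 : ℝ)
  rw [pow_succ, mul_dvd_mul_iff_left (pow_ne_zero j hne)]
  rintro ⟨r, rfl⟩
  simp at hp

/-! ### Assembly -/

theorem proposition2p3 (q : ℝ) (n : ℕ) :
    (0 < q → 2 ≤ n →
      RZ (qEulerian n q) (Set.Iic 0) ∧
        ∀ x : ℝ, (qEulerian n q).IsRoot x → (qEulerian n q).rootMultiplicity x = 1) ∧
    ((n : ℝ) + q ≤ 0 → q ≠ 0 → RZ (qEulerian (n + 1) q) (Set.Ici 1)) ∧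
    (∀ k : ℤ, k < 0 → q = (k : ℝ) →
      RZ (qEulerian n q) (Set.Ici 1) ∧
        ∃ m : ℕ, (m : ℤ) = max ((n : ℤ) + k) 0 ∧
          (X - 1) ^ m ∣ qEulerian n q ∧ ¬ (X - 1) ^ (m + 1) ∣ qEulerian n q) ∧
    (1 ≤ n → qEulerian n (-1) = -(X - 1) ^ (n - 1)) := by
  refine ⟨fun hq hn => ?_, RZ_qEulerian_succ_of_nonpos, ?_, fun hn => ?_⟩
  · obtain ⟨n, rfl⟩ : ∃ m, n = m + 1 := ⟨n - 1, by omega⟩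
    obtain ⟨hRZ, hsimple⟩ := qEulerian_succ_zeros_of_pos n hq
    refine ⟨hRZ.of_forall_aeval fun x hx _ => Set.Iio_subset_Iic_self hx, fun x hx => le_antisymm ?_ ?_⟩
    · by_contra hlt
      exact hsimple x hx
        ((one_lt_rootMultiplicity_iff_isRoot hRZ.ne_zero).1 (not_le.1 hlt)).2
    · exact (rootMultiplicity_pos hRZ.ne_zero).2 hx
  · rintro k hk rfl
    have hk' : (k : ℝ) < 0 := by exact_mod_cast hk
    rcases le_total ((n : ℤ) + k) 0 with hnk | hnk
    · have hRZ := RZ_qEulerian_Ioi_one (n := n) (q := k) (by exact_mod_cast hnk) hk'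
      refine ⟨hRZ.of_forall_aeval fun x hx _ => Set.Ioi_subset_Ici_self hx, 0, by simp [hnk], by simp, ?_⟩
      simpa using not_X_sub_one_pow_succ_dvd (eval_one_ne_zero_of_RZ_Ioi hRZ) 0
    · obtain ⟨a, rfl⟩ : ∃ a : ℕ, k = -((a : ℤ) + 1) := ⟨(-k - 1).toNat, by omega⟩
      obtain ⟨j, rfl⟩ : ∃ j : ℕ, n = a + 1 + j := ⟨n - (a + 1), by omega⟩
      obtain ⟨p, hp, hRZ, -⟩ := exists_qEulerian_neg_eq_mul a j
      push_cast
      rw [hp]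
      refine ⟨fun z hz => ?_, j, by rw [max_eq_left] <;> omega, dvd_mul_right _ _,
        not_X_sub_one_pow_succ_dvd (eval_one_ne_zero_of_RZ_Ioi hRZ) j⟩
      rw [map_mul] at hz
      rcases mul_eq_zero.1 hz with h | h
      · refine ⟨1, Set.self_mem_Ici, ?_⟩
        have h' : (z - 1) ^ j = 0 := by simpa using h
        simpa using sub_eq_zero.1 (eq_zero_of_pow_eq_zero h')
      · obtain ⟨x, hx, hzx⟩ := hRZ z h
        exact ⟨x, Set.Ioi_subset_Ici_self hx, hzx⟩
  · obtain ⟨n, rfl⟩ : ∃ m, n = m + 1 := ⟨n - 1, by omega⟩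
    exact qEulerian_neg_one n
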